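/- Definitions. A tree is a set of finite sequences that contains the empty sequence and is closed under initial segments; it is well-founded if no infinite sequence has all its finite initial segments in the tree. The order type $|T|$ of a well-founded tree $T$ is the ordinal $|\langle\rangle|$ of its root, where $|\sigma|$ is the supremum of $|\sigma'|+1$ over all immediate extensions $\sigma'\in T$ of $\sigma$; if $T$ is not well-founded, $|T|=\infty$. A recursive ordinal is an ordinal of the form $|T|$ for a recursive well-founded tree $T$ of finite sequences of natural numbers. A set system $\mathcal L\subseteq P(X)$ has finite elasticity if there are no infinite sequences $t_0,t_1,\ldots\in X$ and $L_1,L_2,\ldots\in\mathcal L$ with $\{t_0,\ldots,t_{i-1}\}\subseteq L_i\not\ni t_i$ for all $i\ge 1$. Its dimension $\dim\mathcal L$ is the order type of the tree of all finite sequences $\langle\langle t_0,L_1\rangle,\ldots,\langle t_{m-1},L_m\rangle\rangle$ ($m\ge 0$) with $\{t_0,\ldots,t_{i-1}\}\subseteq L_i\in\mathcal L$ for $1\le i\le m$ and $t_j\notin L_j$ for $1\le j\le m-1$. An indexed family of recursive languages over a set $X$ consists of sets $I,J\subseteq\mathbb N$, a bijection $\nu:J\to X$ and a recursive function $\gamma:I\times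 J\to\{0,1\}$ (that is, the partial function on $\mathbb N\times\mathbb N$ with domain $I\times J$ and values $\gamma(i,j)$ is partial recursive). Its languages are $\mathcal L^i=\{\nu(j) : j\in J,\ \gamma(i,j)=1\}$ for $i\in I$; it is without repetition if $\mathcal L^i\neq\mathcal L^{i'}$ whenever $i\ne i'$. Its elasticity and dimension are those of the set system $\{\mathcal L^i : i\in I\}$. Theorem. If an indexed family of recursive languages without repetition has finite elasticity, then its dimension is a recursive ordinal. Conversely, for every recursive ordinal $\alpha$ there is an indexed family of recursive languages without repetition, with recursive index sets $I$ and $J$, whose dimension is $\alpha$. -/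

import Mathlib

universe u

/-- A tree: a set of finite sequences over `A` that contains the empty sequence (its root)
and is closed under initial segments. -/
structure SeqTree (A : Type u) where
  nodes : Set (List A)
  nil_mem : [] ∈ nodes
  mem_of_prefix : ∀ {σ τ : List A}, τ ∈ nodes → σ <+: τ → σ ∈ nodes

namespace SeqTree

variable {A : Type u}

/-- No infinite sequence has all of its finite initial segments in the tree. -/
def IsWellFounded (T : SeqTree A) : Prop :=
  ¬ ∃ a : ℕ → A, ∀ n : ℕ, List.ofFn (fun i : Fin n => a i) ∈ T.nodes

/-- `T.Child τ σ`: the node `τ` is an immediate extension of the node `σ`. -/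
def Child (T : SeqTree A) (τ σ : T.nodes) : Prop :=
  ∃ a : A, (τ : List A) = (σ : List A) ++ [a]

theorem IsWellFounded.wellFounded_child {T : SeqTree A} (h : T.IsWellFounded) :
    WellFounded T.Child := by
  rw [wellFounded_iff_isEmpty_descending_chain]
  refine ⟨fun ⟨f, hf⟩ => h ?_⟩
  choose a ha using hf
  have key : ∀ n : ℕ, (f n : List A) =
      (f 0 : List A) ++ List.ofFn (fun i : Fin n => a i) := by
    intro n
    induction n with
    | zero => simp
    | succ n ih => rw [ha n, ih, List.ofFn_succ']; simp
  -- the branch through the chain: first the entries of `f 0`, then the entries `a 0, a 1, …`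
  refine ⟨fun k => if hk : k < (f 0 : List A).length then (f 0 : List A)[k]
    else a (k - (f 0 : List A).length), fun n => ?_⟩
  refine T.mem_of_prefix (f n).2 ?_
  rw [List.prefix_iff_eq_take, key n]
  apply List.ext_getElem
  · simp
  · intro i h1 h2
    simp [List.getElem_append]

open Classical in
/-- The order type of a tree: if the tree is well-founded, the ordinal `|⟨⟩|` of its root, where
`|σ|` is the supremum of `|τ| + 1` over the immediate extensions `τ` of `σ` in the tree;
otherwise `∞`, written `⊤`. -/
noncomputable def orderType (T : SeqTree A) : WithTop Ordinal.{u} :=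
  if h : T.IsWellFounded then
    (((h.wellFounded_child.apply ⟨[], T.nil_mem⟩).rank : Ordinal.{u}) : WithTop Ordinal.{u})
  else ⊤

/-- A tree of finite sequences of natural numbers is recursive if membership is decidable. -/
def IsRecursive (T : SeqTree ℕ) : Prop :=
  ComputablePred fun σ : List ℕ => σ ∈ T.nodes

end SeqTree

/-- A recursive ordinal is the order type of a recursive well-founded tree of finite sequences of
natural numbers (`Ordinal.lift` only changes the universe). -/
def IsRecursiveOrdinal (α : Ordinal.{u}) : Prop :=
  ∃ (T : SeqTree ℕ) (β : Ordinal.{0}), T.IsRecursive ∧ T.IsWellFounded ∧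
    T.orderType = (β : WithTop Ordinal.{0}) ∧ Ordinal.lift.{u} β = α

section SetSystem

variable {X : Type u}

/-- There are `t₀, t₁, …` in `X` and `L₁, L₂, …` in `𝓛` such that
`{t₀, …, tᵢ₋₁} ⊆ Lᵢ` and `tᵢ ∉ Lᵢ` for every `i ≥ 1` (the value `L 0` plays no role). -/
def HasInfiniteElasticity (𝓛 : Set (Set X)) : Prop :=
  ∃ (t : ℕ → X) (L : ℕ → Set X), ∀ i : ℕ, 1 ≤ i →
    L i ∈ 𝓛 ∧ (∀ k : ℕ, k < i → t k ∈ L i) ∧ t i ∉ L i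

def HasFiniteElasticity (𝓛 : Set (Set X)) : Prop :=
  ¬ HasInfiniteElasticity 𝓛

/-- The list `⟨t₀, L₁⟩, ⟨t₁, L₂⟩, …, ⟨tₘ₋₁, Lₘ⟩` is a production sequence:
`{t₀, …, tᵢ₋₁} ⊆ Lᵢ ∈ 𝓛` for `1 ≤ i ≤ m` and `tⱼ ∉ Lⱼ` for `1 ≤ j ≤ m - 1`.
The entry at position `i` of the list is `⟨tᵢ, Lᵢ₊₁⟩`. -/
def IsProductionSeq (𝓛 : Set (Set X)) (s : List (X × Set X)) : Prop :=
  (∀ (i : ℕ) (hi : i < s.length), s[i].2 ∈ 𝓛 ∧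
    ∀ (k : ℕ) (hk : k ≤ i), s[k].1 ∈ s[i].2) ∧
  ∀ (j : ℕ) (hj : j + 1 < s.length), s[j + 1].1 ∉ s[j].2

/-- The tree of the finite production sequences of a set system. -/
def productionTree (𝓛 : Set (Set X)) : SeqTree (X × Set X) where
  nodes := {s | IsProductionSeq 𝓛 s}
  nil_mem := ⟨fun i hi => absurd hi (by simp), fun j hj => absurd hj (by simp)⟩
  mem_of_prefix := by
    rintro σ _ ⟨h1, h2⟩ ⟨ρ, rfl⟩
    refine ⟨fun i hi => ?_, fun j hj => ?_⟩
    · obtain ⟨ha, hb⟩ := h1 i (by simp; omega)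
      refine ⟨by simpa [List.getElem_append, hi] using ha, fun k hk => ?_⟩
      have hk' : k < σ.length := by omega
      simpa [List.getElem_append, hi, hk'] using hb k hk
    · have hj' : j < σ.length := by omega
      have hh := h2 j (by simp; omega)
      rwa [List.getElem_append_left hj, List.getElem_append_left hj'] at hh

/-- The dimension of a set system, an ordinal or `∞`. -/
noncomputable def setSystemDim (𝓛 : Set (Set X)) : WithTop Ordinal.{u} :=
  (productionTree 𝓛).orderType

end SetSystem

/-- An indexed family of recursive languages over `X`: sets `I, J ⊆ ℕ`, a bijection `ν : J → X`
and a recursive function `γ : I × J → {0, 1}`, that is, the partial function on `ℕ × ℕ` with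
domain `I × J` and values `γ (i, j)` is partial recursive. -/
structure IFRL (X : Type u) where
  I : Set ℕ
  J : Set ℕ
  ν : J → X
  ν_bijective : Function.Bijective ν
  γ : I × J → Bool
  γ_recursive : Partrec fun p : ℕ × ℕ =>
    (⟨p.1 ∈ I ∧ p.2 ∈ J, fun h => γ (⟨p.1, h.1⟩, ⟨p.2, h.2⟩)⟩ : Part Bool)

namespace IFRL

variable {X : Type u}

/-- The `i`-th language of the family. -/
def lang (F : IFRL X) (i : F.I) : Set X :=
  {x | ∃ j : F.J, F.ν j = x ∧ F.γ (i, j) = true}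

/-- The set system formed by the languages of the family. -/
def setSystem (F : IFRL X) : Set (Set X) :=
  Set.range F.lang

def WithoutRepetition (F : IFRL X) : Prop :=
  ∀ i j : F.I, i ≠ j → F.lang i ≠ F.lang j

/-- The dimension of the family is the dimension of its set system. -/
noncomputable def dim (F : IFRL X) : WithTop Ordinal.{u} :=
  setSystemDim F.setSystem

end IFRL

/-!
The rank of the root of a tree can be compared with that of another tree through a simulation:
a relation between nodes, relating the roots, under which every one-letter extension on one side is
answered by a nonempty extension on the other.

The production tree of an indexed family has its letters coded by pairs in `I × J`, the domain of
`γ`. As the domain of a partial recursive function this is the range of a total one `e`, and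
replacing each letter by its indices under `e` yields a tree over `ℕ` with the same order type,
whose nodes can be recognised because `γ` is total on `I × J`.

Conversely, let the words be the nodes of a recursive tree other than the root, and the languages
the sets of nonempty initial segments of such a node. Along a production sequence of this system
each word properly extends the preceding one, so that production sequences and nodes simulate each
other.
-/

universe v

theorem map_lift_uzero (α : WithTop Ordinal.{u}) : α.map Ordinal.lift.{0} = α := by
  cases α <;> simp only [WithTop.map_top, WithTop.map_coe, Ordinal.lift_uzero]

section Rank

variable {A : Type u} {B : Type v} {r : A → A → Prop} {s : B → B → Prop}

theorem rank_lt_rank_of_transGen {a b : B} (ha : Acc s a) (hb : Acc s b)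
    (h : Relation.TransGen s a b) : ha.rank < hb.rank := by
  induction h with
  | single h => exact hb.rank_lt_of_rel h
  | tail _ h ih => exact (ih (hb.inv h)).trans (hb.rank_lt_of_rel h)

theorem exists_acc_lift_rank_le_of_simulation (R : A → B → Prop)
    (hR : ∀ a a' b, R a b → r a' a → ∃ b', R a' b' ∧ Relation.TransGen s b' b)
    {a : A} {b : B} (hb : Acc s b) (hab : R a b) :
    ∃ ha : Acc r a, Ordinal.lift.{v} ha.rank ≤ Ordinal.lift.{u} hb.rank := by
  induction hb.transGen generalizing a with
  | intro b _ ih =>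
    have hstep : ∀ a', r a' a → ∃ b', ∃ hb' : Acc s b', Relation.TransGen s b' b ∧
        ∃ ha' : Acc r a', Ordinal.lift.{v} ha'.rank ≤ Ordinal.lift.{u} hb'.rank := by
      intro a' ha'
      obtain ⟨b', hab', hlt⟩ := hR a a' b hab ha'
      have hb' : Acc s b' := acc_transGen_iff.1 (hb.transGen.inv hlt)
      exact ⟨b', hb', hlt, ih b' hlt hb' hab'⟩
    have ha : Acc r a := ⟨a, fun a' ha' => (hstep a' ha').choose_spec.choose_spec.2.choose⟩
    refine ⟨ha, ?_⟩
    by_contra! hlt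
    obtain ⟨c, hc, hcb⟩ := Ordinal.lt_lift_iff.1 hlt
    rw [ha.rank_eq, Ordinal.lt_iSup_iff] at hc
    obtain ⟨⟨a', haa'⟩, hca'⟩ := hc
    obtain ⟨b', hb', hbb', ha', hle⟩ := hstep a' haa'
    refine lt_irrefl (Ordinal.lift.{u} hb.rank) ?_
    calc Ordinal.lift.{u} hb.rank = Ordinal.lift.{v} c := hcb.symm
      _ ≤ Ordinal.lift.{v} ha'.rank := Ordinal.lift_le.2 (Order.lt_succ_iff.1 hca')
      _ ≤ Ordinal.lift.{u} hb'.rank := hle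
      _ < Ordinal.lift.{u} hb.rank := Ordinal.lift_lt.2 (rank_lt_rank_of_transGen hb' hb hbb')

end Rank

namespace SeqTree

variable {A : Type u} {B : Type v} {T : SeqTree A} {S : SeqTree B}

theorem isWellFounded_of_acc_nil (h : Acc T.Child ⟨[], T.nil_mem⟩) : T.IsWellFounded := by
  rintro ⟨a, ha⟩
  refine (acc_iff_isEmpty_descending_chain.1 h).false
    ⟨fun n => ⟨_, ha n⟩, rfl, fun n => ⟨a n, ?_⟩⟩
  change List.ofFn _ = List.ofFn _ ++ [a n]
  simp only [List.ofFn_succ', Fin.val_castSucc, Fin.val_last, List.concat_eq_append]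

theorem IsWellFounded.orderType_eq_rank (h : T.IsWellFounded) :
    T.orderType = ((h.wellFounded_child.apply ⟨[], T.nil_mem⟩).rank : WithTop Ordinal.{u}) :=
  dif_pos h

theorem orderType_eq_top (h : ¬ T.IsWellFounded) : T.orderType = ⊤ :=
  dif_neg h

theorem transGen_child_append {σ ρ : List A} (hρ : ρ ≠ []) (h : σ ++ ρ ∈ T.nodes) :
    Relation.TransGen T.Child ⟨σ ++ ρ, h⟩ ⟨σ, T.mem_of_prefix h (List.prefix_append σ ρ)⟩ := by
  induction ρ using List.reverseRecOn with
  | nil => exact absurd rfl hρ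
  | append_singleton ρ a ih =>
    have hmem : σ ++ ρ ∈ T.nodes := T.mem_of_prefix h ⟨[a], by simp⟩
    have hchild : T.Child ⟨σ ++ (ρ ++ [a]), h⟩ ⟨σ ++ ρ, hmem⟩ := ⟨a, by simp⟩
    rcases eq_or_ne ρ [] with rfl | hne
    · exact .single ⟨a, rfl⟩
    · exact .head hchild (ih hne hmem)

theorem lift_orderType_le_of_simulation (R : List A → List B → Prop) (hnil : R [] [])
    (hR : ∀ σ a τ, R σ τ → σ ++ [a] ∈ T.nodes → τ ∈ S.nodes →
      ∃ ρ ≠ [], τ ++ ρ ∈ S.nodes ∧ R (σ ++ [a]) (τ ++ ρ)) :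
    T.orderType.map Ordinal.lift.{v} ≤ S.orderType.map Ordinal.lift.{u} := by
  by_cases hS : S.IsWellFounded
  · have hstep : ∀ (σ σ' : T.nodes) (τ : S.nodes), R σ τ → T.Child σ' σ →
        ∃ τ' : S.nodes, R σ' τ' ∧ Relation.TransGen S.Child τ' τ := by
      rintro ⟨σ, _⟩ ⟨_, hσ'⟩ ⟨τ, hτ⟩ hστ ⟨a, rfl⟩
      obtain ⟨ρ, hρ, hτρ, hRρ⟩ := hR σ a τ hστ hσ' hτ
      exact ⟨⟨τ ++ ρ, hτρ⟩, hRρ, transGen_child_append hρ hτρ⟩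
    obtain ⟨hacc, hle⟩ := exists_acc_lift_rank_le_of_simulation
      (fun (σ : T.nodes) (τ : S.nodes) => R σ τ) hstep
      (hS.wellFounded_child.apply ⟨[], S.nil_mem⟩) (a := ⟨[], T.nil_mem⟩) hnil
    rw [(isWellFounded_of_acc_nil hacc).orderType_eq_rank, hS.orderType_eq_rank]
    exact WithTop.coe_le_coe.2 hle
  · rw [orderType_eq_top hS]
    exact le_top

theorem lift_orderType_eq_of_nodes_subset (hT : T.nodes ⊆ {[]}) (hS : S.nodes ⊆ {[]}) :
    T.orderType.map Ordinal.lift.{v} = S.orderType.map Ordinal.lift.{u} :=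
  le_antisymm
    (lift_orderType_le_of_simulation (fun _ _ => True) trivial fun σ a _ _ h =>
      absurd (hT h) (List.append_ne_nil_of_right_ne_nil σ (List.cons_ne_nil a [])))
    (lift_orderType_le_of_simulation (fun _ _ => True) trivial fun σ a _ _ h =>
      absurd (hS h) (List.append_ne_nil_of_right_ne_nil σ (List.cons_ne_nil a [])))

/-- The preimage of a tree under a substitution of letters; it transports trees over other alphabets
to trees over `ℕ`. -/
def comap (φ : A → B) (S : SeqTree B) : SeqTree A where
  nodes := {σ | σ.map φ ∈ S.nodes}
  nil_mem := S.nil_mem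
  mem_of_prefix h hp := S.mem_of_prefix h (hp.map φ)

theorem lift_orderType_comap (φ : A → B)
    (hφ : ∀ σ b, σ ++ [b] ∈ S.nodes → b ∈ Set.range φ) :
    (S.comap φ).orderType.map Ordinal.lift.{v} = S.orderType.map Ordinal.lift.{u} := by
  apply le_antisymm
  · refine lift_orderType_le_of_simulation (fun σ τ => σ.map φ = τ) rfl ?_
    rintro σ a _ rfl hσa -
    have hmem : σ.map φ ++ [φ a] ∈ S.nodes := by simpa [comap] using hσa
    exact ⟨[φ a], List.cons_ne_nil _ _, hmem, by simp⟩
  · refine lift_orderType_le_of_simulation (fun τ σ => σ.map φ = τ) rfl ?_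
    rintro _ b σ rfl hσb -
    obtain ⟨a, rfl⟩ := hφ _ b hσb
    have hmem : σ ++ [a] ∈ (S.comap φ).nodes := by simpa [comap] using hσb
    exact ⟨[a], List.cons_ne_nil _ _, hmem, by simp⟩

/-- The tree whose only node is the root. It is needed because a family without words or without
languages has no enumeration of its index pairs. -/
def rootTree (A : Type u) : SeqTree A where
  nodes := {[]}
  nil_mem := rfl
  mem_of_prefix := by
    rintro σ _ rfl h
    exact List.prefix_nil.1 h

theorem isRecursive_rootTree : (rootTree ℕ).IsRecursive :=
  (Primrec.eq.comp Primrec.id (Primrec.const [])).computablePred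

end SeqTree

theorem isRecursiveOrdinal_iff {α : Ordinal.{u}} : IsRecursiveOrdinal α ↔
    ∃ T : SeqTree ℕ, T.IsRecursive ∧ T.orderType.map Ordinal.lift.{u} = α := by
  constructor
  · rintro ⟨T, β, hT, -, hβ, rfl⟩
    exact ⟨T, hT, by rw [hβ, WithTop.map_coe]⟩
  · rintro ⟨T, hT, h⟩
    by_cases hwf : T.IsWellFounded
    · have hrank := hwf.orderType_eq_rank
      rw [hrank, WithTop.map_coe, WithTop.coe_inj] at h
      exact ⟨T, _, hT, hwf, hrank, h⟩
    · rw [SeqTree.orderType_eq_top hwf] at h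
      exact absurd h.symm WithTop.coe_ne_top

section Computability

variable {α β : Type*} [Primcodable α] [Primcodable β]

theorem computablePred_comp {p : β → Prop} (hp : ComputablePred p) {f : α → β}
    (hf : Computable f) : ComputablePred fun a => p (f a) :=
  hp.computable_of_manyOneReducible (.mk p hf)

theorem computablePred_and {p q : α → Prop} (hp : ComputablePred p) (hq : ComputablePred q) :
    ComputablePred fun a => p a ∧ q a := by
  obtain ⟨f, hf, rfl⟩ := ComputablePred.computable_iff.1 hp
  obtain ⟨g, hg, rfl⟩ := ComputablePred.computable_iff.1 hq
  exact ComputablePred.computable_iff.2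
    ⟨fun a => f a && g a, Primrec.and.to_comp.comp hf hg, by simp⟩

theorem computablePred_forall_lt {p : α → ℕ → Prop} {n : α → ℕ} (hn : Computable n)
    (hp : ComputablePred fun q : α × ℕ => p q.1 q.2) :
    ComputablePred fun a => ∀ k < n a, p a k := by
  obtain ⟨f, hf, hpf⟩ := ComputablePred.computable_iff.1 hp
  have hpf' : ∀ a k, p a k ↔ f (a, k) = true := fun a k => iff_of_eq (congrFun hpf (a, k))
  have hstep : Computable₂ fun (a : α) (r : ℕ × Bool) => f (a, r.1) && r.2 :=
    Primrec.and.to_comp.comp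
      (hf.comp (Computable.fst.pair (Computable.fst.comp Computable.snd)))
      (Computable.snd.comp Computable.snd)
  refine ComputablePred.computable_iff.2
    ⟨_, Computable.nat_rec hn (Computable.const true) hstep, funext fun a => propext ?_⟩
  induction n a with
  | zero => simp
  | succ n ih => simp only [Bool.and_eq_true, ← hpf', ← ih, Nat.forall_lt_succ_right, and_comm]

theorem partrec_restrict {p : α → Prop} (hp : ComputablePred p) {f : α → β} (hf : Computable f) :
    Partrec fun a => (⟨p a, fun _ => f a⟩ : Part β) := by
  obtain ⟨c, hc, rfl⟩ := ComputablePred.computable_iff.1 hp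
  refine (Partrec.cond hc hf.partrec Partrec.none).of_eq fun a => ?_
  cases h : c a
  · exact (Part.eq_none_iff'.2 (by simp [h])).symm
  · symm
    simp only [cond_true, PFun.coe_val]
    exact Part.eq_some_iff.2 ⟨h, rfl⟩

theorem exists_computable_range_eq_ran {g : α →. β} (hg : Partrec g) (hne : g.ran.Nonempty) :
    ∃ f : ℕ → β, Computable f ∧ Set.range f = g.ran := by
  obtain ⟨b₀, hb₀⟩ := hne
  obtain ⟨c, hc⟩ := Nat.Partrec.Code.exists_code.1 hg
  have mem_eval : ∀ m x, x ∈ c.eval m ↔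
      ∃ a, Encodable.decode m = some a ∧ ∃ b ∈ g a, Encodable.encode b = x := by
    intro m x
    simp [hc]
  let f : ℕ → β := fun n =>
    ((Nat.Partrec.Code.evaln n.unpair.1 c n.unpair.2).bind Encodable.decode).getD b₀
  have hf : Computable f := by
    have hevaln : Computable fun n : ℕ => Nat.Partrec.Code.evaln n.unpair.1 c n.unpair.2 :=
      Nat.Partrec.Code.primrec_evaln.to_comp.comp
        (((Computable.fst.comp Computable.unpair).pair (Computable.const c)).pair
          (Computable.snd.comp Computable.unpair))
    exact Computable.option_getD
      (Computable.option_bind hevaln (Computable.decode.comp Computable.snd)) (Computable.const b₀)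
  refine ⟨f, hf, Set.Subset.antisymm ?_ ?_⟩
  · rintro _ ⟨n, rfl⟩
    rcases h : Nat.Partrec.Code.evaln n.unpair.1 c n.unpair.2 with _ | x
    · simpa [f, h] using hb₀
    · obtain ⟨a, -, b, hb, rfl⟩ := (mem_eval _ x).1 (Nat.Partrec.Code.evaln_sound h)
      have hfn : f n = b := by simp [f, h]
      exact hfn ▸ ⟨a, hb⟩
  · rintro b ⟨a, hb⟩
    obtain ⟨k, hk⟩ := Nat.Partrec.Code.evaln_complete.1
      ((mem_eval (Encodable.encode a) _).2 ⟨a, Encodable.encodek a, b, hb, rfl⟩)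
    exact ⟨Nat.pair k (Encodable.encode a), by simp [f, Option.mem_def.1 hk]⟩

end Computability

section ProductionTree

variable {X : Type u} {𝓛 : Set (Set X)}

theorem hasFiniteElasticity_iff_isWellFounded :
    HasFiniteElasticity 𝓛 ↔ (productionTree 𝓛).IsWellFounded := by
  refine not_congr ⟨?_, ?_⟩
  · rintro ⟨t, L, h⟩
    refine ⟨fun n => (t n, L (n + 1)), fun n => ⟨fun i hi => ?_, fun j hj => ?_⟩⟩
    · simp only [List.getElem_ofFn]
      exact ⟨(h (i + 1) (by omega)).1, fun k hk => (h (i + 1) (by omega)).2.1 k (by omega)⟩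
    · simp only [List.getElem_ofFn]
      exact (h (j + 1) (by omega)).2.2
  · rintro ⟨a, ha⟩
    refine ⟨fun n => (a n).1, fun n => (a (n - 1)).2, fun i hi => ?_⟩
    obtain ⟨i, rfl⟩ := Nat.exists_eq_add_of_le' hi
    obtain ⟨hmem, hnotMem⟩ := ha (i + 2)
    have hi := hmem i (by simp)
    have hi' := hnotMem i (by simp)
    simp only [List.getElem_ofFn] at hi hi'
    exact ⟨hi.1, fun k hk => hi.2 k (by omega), hi'⟩

theorem IsProductionSeq.mem {s : List (X × Set X)} (hs : IsProductionSeq 𝓛 s) {r : X × Set X}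
    (hr : r ∈ s) : r.2 ∈ 𝓛 ∧ r.1 ∈ r.2 := by
  obtain ⟨i, hi, rfl⟩ := List.getElem_of_mem hr
  exact ⟨(hs.1 i hi).1, (hs.1 i hi).2 i le_rfl⟩

theorem isProductionSeq_append_singleton {s : List (X × Set X)} {p : X × Set X} :
    IsProductionSeq 𝓛 (s ++ [p]) ↔ IsProductionSeq 𝓛 s ∧ p.2 ∈ 𝓛 ∧ (∀ r ∈ s ++ [p], r.1 ∈ p.2) ∧
      ∀ q ∈ s.getLast?, p.1 ∉ q.2 := by
  constructor
  · intro h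
    obtain ⟨hp, hmem⟩ := h.1 s.length (by simp)
    simp only [List.getElem_concat_length] at hp hmem
    refine ⟨(productionTree 𝓛).mem_of_prefix h (List.prefix_append s [p]), hp, ?_, ?_⟩
    · intro r hr
      obtain ⟨k, hk, rfl⟩ := List.getElem_of_mem hr
      exact hmem k (by simpa [Nat.lt_succ_iff] using hk)
    · rcases List.eq_nil_or_concat s with rfl | ⟨σ, q, rfl⟩
      · simp
      · simpa using h.2 σ.length (by simp)
  · rintro ⟨hs, hp, hmem, hlast⟩
    refine ⟨fun i hi => ?_, fun j hj => ?_⟩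
    · rcases (Nat.lt_succ_iff.1 (by simpa using hi)).lt_or_eq with hi | rfl
      · rw [List.getElem_append_left hi]
        refine ⟨(hs.1 i hi).1, fun k hk => ?_⟩
        rw [List.getElem_append_left (hk.trans_lt hi)]
        exact (hs.1 i hi).2 k hk
      · simp only [List.getElem_concat_length]
        exact ⟨hp, fun k _ => hmem _ (List.getElem_mem _)⟩
    · have hj' : j + 1 ≤ s.length := by simpa [Nat.succ_le_iff] using hj
      rcases hj'.lt_or_eq with hj | hj
      · rw [List.getElem_append_left hj, List.getElem_append_left (Nat.lt_of_succ_lt hj)]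
        exact hs.2 j hj
      · simp only [hj, List.getElem_concat_length]
        rw [List.getElem_append_left (by omega)]
        exact hlast _ (by simp [List.getLast?_eq_getElem?, ← hj])

theorem isRecursive_comap_productionTree {φ : ℕ → X × Set X} (hφ : ∀ n, (φ n).2 ∈ 𝓛)
    (hc : ComputablePred fun q : ℕ × ℕ => (φ q.1).1 ∈ (φ q.2).2) :
    ((productionTree 𝓛).comap φ).IsRecursive := by
  have hget : Computable fun q : List ℕ × ℕ => q.1.getD q.2 0 := (Primrec.list_getD 0).to_comp
  have hletters : ComputablePred fun q : (List ℕ × ℕ) × ℕ =>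
      (φ (q.1.1.getD q.2 0)).1 ∈ (φ (q.1.1.getD q.1.2 0)).2 :=
    computablePred_comp hc <|
      (hget.comp ((Computable.fst.comp Computable.fst).pair Computable.snd)).pair
        (hget.comp Computable.fst)
  have hmem : ComputablePred fun σ : List ℕ => ∀ i < σ.length, ∀ k < i + 1,
      (φ (σ.getD k 0)).1 ∈ (φ (σ.getD i 0)).2 :=
    computablePred_forall_lt Computable.list_length
      (computablePred_forall_lt (Computable.succ.comp Computable.snd) hletters)
  have hnotMem : ComputablePred fun σ : List ℕ => ∀ j < σ.length - 1,
      (φ (σ.getD (j + 1) 0)).1 ∉ (φ (σ.getD j 0)).2 :=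
    computablePred_forall_lt (Primrec.pred.to_comp.comp Computable.list_length) <|
      ComputablePred.not <| computablePred_comp hc <|
        (hget.comp (Computable.fst.pair (Computable.succ.comp Computable.snd))).pair hget
  refine (computablePred_and hmem hnotMem).of_eq fun σ => ?_
  change _ ↔ IsProductionSeq 𝓛 (σ.map φ)
  simp only [IsProductionSeq, List.length_map, List.getElem_map, hφ, true_and]
  refine and_congr (forall₂_congr fun i hi => forall_congr' fun k => ?_)
    (forall_congr' fun j => ?_)
  · rw [Nat.lt_succ_iff]
    refine forall_congr' fun hk => ?_
    rw [List.getD_eq_getElem _ _ hi, List.getD_eq_getElem _ _ (hk.trans_lt hi)]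
  · rw [Nat.lt_sub_iff_add_lt]
    refine forall_congr' fun hj => ?_
    rw [List.getD_eq_getElem _ _ hj, List.getD_eq_getElem _ _ (Nat.lt_of_succ_lt hj)]

end ProductionTree

namespace IFRL

variable {X : Type u} (F : IFRL X)

theorem ν_mem_lang_iff {i : F.I} {j : F.J} : F.ν j ∈ F.lang i ↔ F.γ (i, j) = true := by
  constructor
  · rintro ⟨j', hj', h⟩
    rwa [F.ν_bijective.1 hj'] at h
  · exact fun h => ⟨j, rfl, h⟩

theorem exists_surjective_computable [Nonempty F.I] [Nonempty F.J] :
    ∃ e : ℕ → F.I × F.J, Function.Surjective e ∧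
      Computable fun n => (((e n).1 : ℕ), ((e n).2 : ℕ)) := by
  let g : ℕ × ℕ →. ℕ × ℕ := fun p => ⟨p.1 ∈ F.I ∧ p.2 ∈ F.J, fun _ => p⟩
  have hg : Partrec g := F.γ_recursive.map (Computable.fst (β := Bool)).to₂
  have hran : g.ran = F.I ×ˢ F.J := by
    ext p
    constructor
    · rintro ⟨p, hp, rfl⟩
      exact hp
    · exact fun hp => ⟨p, hp, rfl⟩
  obtain ⟨e, he, herange⟩ := exists_computable_range_eq_ran hg <| hran ▸
    (Set.nonempty_coe_sort.1 ‹_›).prod (Set.nonempty_coe_sort.1 ‹_›)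
  rw [hran] at herange
  have hmem : ∀ n, e n ∈ F.I ×ˢ F.J := fun n => herange ▸ Set.mem_range_self n
  refine ⟨fun n => (⟨(e n).1, (hmem n).1⟩, ⟨(e n).2, (hmem n).2⟩), ?_, he⟩
  rintro ⟨⟨i, hi⟩, ⟨j, hj⟩⟩
  obtain ⟨n, hn⟩ : (i, j) ∈ Set.range e := herange ▸ ⟨hi, hj⟩
  exact ⟨n, by simp [hn]⟩

theorem exists_isRecursive_lift_orderType_eq_dim_of_nonempty [Nonempty F.I] [Nonempty F.J] :
    ∃ T : SeqTree ℕ, T.IsRecursive ∧ T.orderType.map Ordinal.lift.{u} = F.dim := by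
  obtain ⟨e, hsurj, he⟩ := F.exists_surjective_computable
  let φ : ℕ → X × Set X := fun n => (F.ν (e n).2, F.lang (e n).1)
  have hφ : ∀ σ p, σ ++ [p] ∈ (productionTree F.setSystem).nodes → p ∈ Set.range φ := by
    rintro σ ⟨x, L⟩ hσ
    obtain ⟨i, rfl⟩ := (isProductionSeq_append_singleton.1 hσ).2.1
    obtain ⟨j, rfl⟩ := F.ν_bijective.2 x
    obtain ⟨n, hn⟩ := hsurj (i, j)
    exact ⟨n, by simp only [φ, hn]⟩
  have hγ : Computable fun q : ℕ × ℕ => F.γ ((e q.2).1, (e q.1).2) :=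
    (F.γ_recursive.comp ((Computable.fst.comp (he.comp Computable.snd)).pair
      (Computable.snd.comp (he.comp Computable.fst)))).of_eq_tot
      fun q => ⟨⟨(e q.2).1.2, (e q.1).2.2⟩, rfl⟩
  refine ⟨(productionTree F.setSystem).comap φ, isRecursive_comap_productionTree
    (fun n => Set.mem_range_self _) (ComputablePred.computable_iff.2 ⟨_, hγ, ?_⟩), ?_⟩
  · exact funext fun q => propext F.ν_mem_lang_iff
  · exact (SeqTree.lift_orderType_comap φ hφ).trans (map_lift_uzero _)

theorem exists_isRecursive_lift_orderType_eq_dim :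
    ∃ T : SeqTree ℕ, T.IsRecursive ∧ T.orderType.map Ordinal.lift.{u} = F.dim := by
  by_cases hne : Nonempty F.I ∧ Nonempty F.J
  · obtain ⟨_, _⟩ := hne
    exact F.exists_isRecursive_lift_orderType_eq_dim_of_nonempty
  · have hnodes : (productionTree F.setSystem).nodes ⊆ {[]} := by
      refine fun s hs => List.eq_nil_iff_forall_not_mem.2 fun p hp => hne ?_
      obtain ⟨i, -⟩ := (IsProductionSeq.mem hs hp).1
      obtain ⟨j, -⟩ := F.ν_bijective.2 p.1
      exact ⟨⟨i⟩, ⟨j⟩⟩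
    exact ⟨.rootTree ℕ, SeqTree.isRecursive_rootTree,
      (SeqTree.lift_orderType_eq_of_nodes_subset subset_rfl hnodes).trans (map_lift_uzero _)⟩

end IFRL

section InitialSegments

variable {A : Type u} {X : Type v} {T : SeqTree A}

/-- The set system over the index type `X` of a family `w` of sequences, consisting of the sets
`{x | w x <+: w y}`: up to indexing, the language of `y` is the set of initial segments of `w y`. -/
def initialSegmentSystem (w : X → List A) : Set (Set X) :=
  Set.range fun y => {x | w x <+: w y}

theorem lift_orderType_le_setSystemDim (w : X → List A) (hw : Set.range w = T.nodes \ {[]}) :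
    T.orderType.map Ordinal.lift.{v} ≤
      (setSystemDim (initialSegmentSystem w)).map Ordinal.lift.{u} := by
  refine SeqTree.lift_orderType_le_of_simulation
    (fun σ s => ∀ r ∈ s, ∀ x ∈ r.2, w x <+: σ) (by simp) ?_
  intro σ a s hσs hσa hs
  obtain ⟨y, hy⟩ : σ ++ [a] ∈ Set.range w := hw ▸ ⟨hσa, by simp⟩
  let p : X × Set X := (y, {x | w x <+: w y})
  have hσy : σ <+: w y := hy ▸ List.prefix_append σ [a]
  refine ⟨[p], List.cons_ne_nil _ _, isProductionSeq_append_singleton.2 ⟨hs, ⟨y, rfl⟩, ?_, ?_⟩, ?_⟩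
  · intro r hr
    rcases List.mem_append.1 hr with hr | hr
    · exact (hσs r hr r.1 (hs.mem hr).2).trans hσy
    · rw [List.mem_singleton.1 hr]
      exact List.prefix_rfl
  · intro q hq hmem
    have hlen := (hσs q (List.mem_of_getLast? hq) y hmem).length_le
    simp [hy] at hlen
  · intro r hr x hx
    rcases List.mem_append.1 hr with hr | hr
    · exact (hσs r hr x hx).trans (List.prefix_append σ [a])
    · rw [List.mem_singleton.1 hr] at hx
      exact hy ▸ hx

theorem setSystemDim_le_lift_orderType (w : X → List A) (hw : Set.range w = T.nodes \ {[]}) :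
    (setSystemDim (initialSegmentSystem w)).map Ordinal.lift.{u} ≤
      T.orderType.map Ordinal.lift.{v} := by
  have hwmem : ∀ x, w x ∈ T.nodes ∧ w x ≠ [] := fun x => hw.subset ⟨x, rfl⟩
  refine SeqTree.lift_orderType_le_of_simulation
    (fun s σ => s = [] ∧ σ = [] ∨ ∃ q ∈ s.getLast?, w q.1 = σ) (.inl ⟨rfl, rfl⟩) ?_
  rintro s ⟨x, L⟩ σ hsσ hsp -
  obtain ⟨hs, ⟨y, rfl⟩, hmem, hlast⟩ := isProductionSeq_append_singleton.1 hsp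
  suffices hσx : ∃ ρ ≠ [], σ ++ ρ = w x by
    obtain ⟨ρ, hρ, hσx⟩ := hσx
    exact ⟨ρ, hρ, hσx ▸ (hwmem x).1, .inr ⟨_, List.getLast?_concat, hσx.symm⟩⟩
  rcases hsσ with ⟨-, rfl⟩ | ⟨⟨u, M⟩, hu, rfl⟩
  · exact ⟨w x, (hwmem x).2, rfl⟩
  · obtain ⟨⟨z, rfl⟩, huz⟩ := hs.mem (List.mem_of_getLast? hu)
    have hxz : ¬ w x <+: w z := hlast _ hu
    have hxy : w x <+: w y := hmem (x, _) (List.mem_append_right s (List.mem_singleton_self _))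
    have huy : w u <+: w y := hmem _ (List.mem_append_left _ (List.mem_of_getLast? hu))
    rcases List.prefix_or_prefix_of_prefix huy hxy with ⟨ρ, hρ⟩ | hxu
    · refine ⟨ρ, ?_, hρ⟩
      rintro rfl
      rw [List.append_nil] at hρ
      exact hxz (hρ ▸ huz)
    · exact absurd (hxu.trans huz) hxz

theorem lift_setSystemDim_initialSegmentSystem (w : X → List A)
    (hw : Set.range w = T.nodes \ {[]}) :
    (setSystemDim (initialSegmentSystem w)).map Ordinal.lift.{u} =
      T.orderType.map Ordinal.lift.{v} :=
  le_antisymm (setSystemDim_le_lift_orderType w hw) (lift_orderType_le_setSystemDim w hw)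

end InitialSegments

namespace SeqTree

variable (T : SeqTree ℕ)

/-- The codes of the nodes other than the root, which index both the words and the languages of
`SeqTree.initialSegmentFamily`. The root is left out because a production sequence starting with it
would raise the dimension above the order type of the tree. -/
def nonrootCodes : Set ℕ :=
  {n | Denumerable.ofNat (List ℕ) n ∈ T.nodes \ {[]}}

variable {T}

theorem IsRecursive.computablePred_nonrootCodes (hT : T.IsRecursive) :
    ComputablePred fun n => n ∈ T.nonrootCodes :=
  computablePred_and
    (computablePred_comp hT (Computable.ofNat (List ℕ)))
    (Primrec.eq.comp (Primrec.ofNat (List ℕ)) (Primrec.const [])).computablePred.not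

theorem computable_decide_prefix : Computable fun p : List ℕ × List ℕ => decide (p.1 <+: p.2) :=
  PrimrecPred.computablePred ((Primrec.eq.comp Primrec.fst
      (Primrec.list_take.comp (Primrec.list_length.comp Primrec.fst) Primrec.snd)).of_eq
    fun _ => List.prefix_iff_eq_take.symm) |>.decide

/-- The indexed family whose words are the nodes of `T` other than the root, the language of a node
consisting of its nonempty initial segments. -/
def initialSegmentFamily (hT : T.IsRecursive) : IFRL (ULift.{u} T.nonrootCodes) where
  I := T.nonrootCodes
  J := T.nonrootCodes
  ν := ULift.up
  ν_bijective := ULift.up_bijective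
  γ p := decide (Denumerable.ofNat (List ℕ) p.2 <+: Denumerable.ofNat (List ℕ) p.1)
  γ_recursive :=
    partrec_restrict
      (computablePred_and
        (computablePred_comp hT.computablePred_nonrootCodes Computable.fst)
        (computablePred_comp hT.computablePred_nonrootCodes Computable.snd))
      (computable_decide_prefix.comp
        (((Computable.ofNat _).comp Computable.snd).pair
          ((Computable.ofNat _).comp Computable.fst)))

theorem mem_lang_initialSegmentFamily (hT : T.IsRecursive) {i : T.nonrootCodes}
    {x : ULift.{u} T.nonrootCodes} : x ∈ (initialSegmentFamily hT).lang i ↔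
      Denumerable.ofNat (List ℕ) x.down <+: Denumerable.ofNat (List ℕ) i :=
  (initialSegmentFamily hT).ν_mem_lang_iff.trans decide_eq_true_iff

theorem withoutRepetition_initialSegmentFamily (hT : T.IsRecursive) :
    (initialSegmentFamily.{u} hT).WithoutRepetition := by
  intro i j hij hlang
  have hij' : Denumerable.ofNat (List ℕ) i <+: Denumerable.ofNat (List ℕ) j :=
    (mem_lang_initialSegmentFamily hT (x := ⟨i⟩)).1
      (hlang ▸ (mem_lang_initialSegmentFamily hT).2 List.prefix_rfl)
  have hji : Denumerable.ofNat (List ℕ) j <+: Denumerable.ofNat (List ℕ) i :=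
    (mem_lang_initialSegmentFamily hT (x := ⟨j⟩)).1
      (hlang ▸ (mem_lang_initialSegmentFamily hT).2 List.prefix_rfl)
  exact hij (Subtype.ext ((Denumerable.eqv (List ℕ)).symm.injective
    (hij'.eq_of_length (hij'.length_le.antisymm hji.length_le))))

theorem dim_initialSegmentFamily (hT : T.IsRecursive) :
    (initialSegmentFamily.{u} hT).dim = T.orderType.map Ordinal.lift.{u} := by
  let w : ULift.{u} T.nonrootCodes → List ℕ := fun x => Denumerable.ofNat (List ℕ) x.down
  have hw : Set.range w = T.nodes \ {[]} := by
    ext σ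
    constructor
    · rintro ⟨x, rfl⟩
      exact x.down.2
    · exact fun hσ => ⟨⟨Encodable.encode σ, by simpa [nonrootCodes] using hσ⟩, by simp [w]⟩
  have hsystem : (initialSegmentFamily.{u} hT).setSystem = initialSegmentSystem w := by
    ext L
    constructor
    · rintro ⟨i, rfl⟩
      exact ⟨⟨i⟩, Set.ext fun x => (mem_lang_initialSegmentFamily hT).symm⟩
    · rintro ⟨y, rfl⟩
      exact ⟨y.down, Set.ext fun x => mem_lang_initialSegmentFamily hT⟩
  rw [IFRL.dim, hsystem, ← lift_setSystemDim_initialSegmentSystem w hw, map_lift_uzero]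

end SeqTree

theorem theorem1_general :
    (∀ (X : Type u) (F : IFRL X), HasFiniteElasticity F.setSystem →
      ∃ α : Ordinal.{u}, IsRecursiveOrdinal α ∧ F.dim = (α : WithTop Ordinal.{u})) ∧
    (∀ α : Ordinal.{u}, IsRecursiveOrdinal α →
      ∃ (X : Type u) (F : IFRL X), F.WithoutRepetition ∧
        (ComputablePred fun i : ℕ => i ∈ F.I) ∧ (ComputablePred fun j : ℕ => j ∈ F.J) ∧
        F.dim = (α : WithTop Ordinal.{u})) := by
  refine ⟨fun X F hF => ?_, fun α hα => ?_⟩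
  · obtain ⟨T, hT, hdim⟩ := F.exists_isRecursive_lift_orderType_eq_dim
    have hα := (hasFiniteElasticity_iff_isWellFounded.1 hF).orderType_eq_rank
    exact ⟨_, isRecursiveOrdinal_iff.2 ⟨T, hT, hdim.trans hα⟩, hα⟩
  · obtain ⟨T, hT, hdim⟩ := isRecursiveOrdinal_iff.1 hα
    exact ⟨_, SeqTree.initialSegmentFamily hT, SeqTree.withoutRepetition_initialSegmentFamily hT,
      hT.computablePred_nonrootCodes, hT.computablePred_nonrootCodes,
      (SeqTree.dim_initialSegmentFamily hT).trans hdim⟩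

theorem theorem1 :
    (∀ (X : Type u) (F : IFRL X), F.WithoutRepetition → HasFiniteElasticity F.setSystem →
      ∃ α : Ordinal.{u}, IsRecursiveOrdinal α ∧ F.dim = (α : WithTop Ordinal.{u})) ∧
    (∀ α : Ordinal.{u}, IsRecursiveOrdinal α →
      ∃ (X : Type u) (F : IFRL X), F.WithoutRepetition ∧
        (ComputablePred fun i : ℕ => i ∈ F.I) ∧ (ComputablePred fun j : ℕ => j ∈ F.J) ∧
        F.dim = (α : WithTop Ordinal.{u})) :=
  ⟨fun X F _ => theorem1_general.1 X F, theorem1_general.2⟩
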